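/- Conventions. All graphs are simple and undirected, and $V(G)\subseteq\mathbb{N}$. A graph $G$ is *highly computable* if $V(G)$ and the adjacency relation are decidable, $G$ is locally finite, and the degree function $V(G)\to\mathbb{N}$ is computable; a *description* of $G$ is a triple of programs: one for the characteristic function of $V(G)$, one for the characteristic function of the adjacency relation on $\mathbb{N}^2$, and one for the degree function (defined exactly on $V(G)$). For a finite set $E\subseteq E(G)$ let $\operatorname{Comp}_G(E)$ be the number of infinite connected components of $G\smallsetminus E$. The *number of ends* of a connected graph $G$ is $\sup_E \operatorname{Comp}_G(E)$ over all finite $E\subseteq E(G)$, and $\operatorname{Sepmax}(G)$ is the collection of all finite $E\subseteq E(G)$ such that $\operatorname{Comp}_G(E)$ equals the number of ends of $G$. For $Y\subseteq\mathbb{N}$, $Y'$ is the set of all $e$ such that the $e$-th oracle program (without input) halts with oracle $Y$. Proposition. Let $f$ be a (possibly partial) function which, given any description of an infinite connected highly computable graph $G$ with finitely many ends, outputs an element of $\operatorname{Sepmax}(G)$, presented as a finite list of edges; on other inputs $f$ is arbitrary or undefined. Then $f\geq_T \mathbf{0}''$, that is, the characteristic function of $\emptyset''$ is computable with oracle $f$.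 -/

import Mathlib

/-! ### Ends of graphs -/

namespace SepMax

/-- The number of infinite connected components of `G` after removing the finite edge set `E`.
(Deleting edges here keeps the vertices that become isolated; these lie in one-point components,
so they do not affect the number of infinite components.) -/
noncomputable def numInfComp {V : Type*} (G : SimpleGraph V) (E : Finset (Sym2 V)) : ℕ∞ :=
  Set.encard {C : (G.deleteEdges (E : Set (Sym2 V))).ConnectedComponent | C.supp.Infinite}

/-- The number of ends: the supremum of the number of infinite connected components of `G ∖ E`,
for `E` ranging over all finite sets of edges of `G`. -/
noncomputable def numEnds {V : Type*} (G : SimpleGraph V) : ℕ∞ :=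
  ⨆ (E : Finset (Sym2 V)) (_ : (E : Set (Sym2 V)) ⊆ G.edgeSet), numInfComp G E

/-- The finite sets of edges whose removal leaves as many infinite connected components as `G`
has ends. -/
def sepmax {V : Type*} (G : SimpleGraph V) : Set (Finset (Sym2 V)) :=
  {E | (E : Set (Sym2 V)) ⊆ G.edgeSet ∧ numInfComp G E = numEnds G}

/-! ### Highly computable graphs -/

open Classical in
/-- The characteristic function of a set of natural numbers. -/
noncomputable def charFn (A : Set ℕ) (n : ℕ) : ℕ := if n ∈ A then 1 else 0

/-- A description of a highly computable graph consists of a program for the vertex set,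
a program for the adjacency relation and a program for the degree function. -/
abbrev GraphCode : Type := Nat.Partrec.Code × Nat.Partrec.Code × Nat.Partrec.Code

/-- The triple of programs `c` describes the graph `G` with vertex set `V ⊆ ℕ` as a highly
computable graph: the first program decides the vertex set, the second one decides the adjacency
relation (as a subset of `ℕ × ℕ`), `G` is locally finite, and the third program computes the
degree function `V → ℕ`. A graph is highly computable exactly if it has such a description. -/
structure Describes (c : GraphCode) (V : Set ℕ) (G : SimpleGraph V) : Prop where
  vertices : ∀ v : ℕ, c.1.eval v = Part.some (charFn V v)
  adjacency : ∀ u v : ℕ, c.2.1.eval (Nat.pair u v) =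
    Part.some (charFn {p | ∃ x y : V, G.Adj x y ∧ p = Nat.pair x y} (Nat.pair u v))
  locallyFinite : ∀ v : V, (G.neighborSet v).Finite
  degree : ∀ v n : ℕ, n ∈ c.2.2.eval v ↔ ∃ h : v ∈ V, (G.neighborSet ⟨v, h⟩).ncard = n

/-- The list `l` of pairs of natural numbers lists (in any order and orientation, possibly with
repetitions) the unordered pairs in the finite set `E`. -/
def Lists (l : List (ℕ × ℕ)) {V : Set ℕ} (E : Finset (Sym2 V)) : Prop :=
  Sym2.map (fun x : V => (x : ℕ)) '' (E : Set (Sym2 V)) = {e | ∃ p ∈ l, e = s(p.1, p.2)}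

/-- `f`, given a description of any infinite connected highly computable graph `G` with finitely
many ends, outputs (a list of the edges of) an element of `sepmax G`. On other inputs `f` may take
any value, or be undefined. -/
def FindsSepmax (f : GraphCode →. List (ℕ × ℕ)) : Prop :=
  ∀ (c : GraphCode) (V : Set ℕ) (G : SimpleGraph V), Describes c V G →
    V.Infinite → G.Connected → numEnds G ≠ ⊤ →
      ∃ l ∈ f c, ∃ E ∈ sepmax G, Lists l E

/-! ### Turing jumps -/

/-- Programs with access to an oracle: the programs for partial recursive functions, with one
further basic instruction `oracle` that queries the oracle. -/
inductive OracleCode : Type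
  | zero : OracleCode
  | succ : OracleCode
  | left : OracleCode
  | right : OracleCode
  | oracle : OracleCode
  | pair : OracleCode → OracleCode → OracleCode
  | comp : OracleCode → OracleCode → OracleCode
  | prec : OracleCode → OracleCode → OracleCode
  | rfind : OracleCode → OracleCode

/-- The partial function computed by an oracle program with oracle `g`. -/
def OracleCode.eval (g : ℕ →. ℕ) : OracleCode → ℕ →. ℕ
  | .zero => fun _ => Part.some 0
  | .succ => fun n => Part.some (n + 1)
  | .left => fun n => Part.some n.unpair.1
  | .right => fun n => Part.some n.unpair.2
  | .oracle => g
  | .pair a b => fun n => Nat.pair <$> a.eval g n <*> b.eval g n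
  | .comp a b => fun n => b.eval g n >>= a.eval g
  | .prec a b => fun p =>
      p.unpair.2.rec (a.eval g p.unpair.1) fun y IH => do
        let i ← IH
        b.eval g (Nat.pair p.unpair.1 (Nat.pair y i))
  | .rfind a => fun n => Nat.rfind fun k => (fun m => m = 0) <$> a.eval g (Nat.pair n k)

/-- An effective bijective numbering of the oracle programs. -/
def OracleCode.ofNat : ℕ → OracleCode
  | 0 => .zero
  | 1 => .succ
  | 2 => .left
  | 3 => .right
  | 4 => .oracle
  | n + 5 =>
    have h : n / 4 < n + 5 := by omega
    have h₁ : (n / 4).unpair.1 < n + 5 := lt_of_le_of_lt (Nat.unpair_left_le _) h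
    have h₂ : (n / 4).unpair.2 < n + 5 := lt_of_le_of_lt (Nat.unpair_right_le _) h
    match n % 4 with
    | 0 => .pair (ofNat (n / 4).unpair.1) (ofNat (n / 4).unpair.2)
    | 1 => .comp (ofNat (n / 4).unpair.1) (ofNat (n / 4).unpair.2)
    | 2 => .prec (ofNat (n / 4).unpair.1) (ofNat (n / 4).unpair.2)
    | _ => .rfind (ofNat (n / 4))

/-- The characteristic function of a set, as an oracle. -/
noncomputable def setOracle (A : Set ℕ) : ℕ →. ℕ := fun n => Part.some (charFn A n)

/-- The Turing jump of `A`: the set of all `e` such that the `e`-th oracle program, started with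
the trivial input `0` and with oracle `A`, halts. -/
def jump (A : Set ℕ) : Set ℕ := {e | ((OracleCode.ofNat e).eval (setOracle A) 0).Dom}

/-- A partial function between types with an effective numbering, as a partial function on
natural numbers. -/
def natOracle {α β : Type*} [Primcodable α] [Primcodable β] (f : α →. β) : ℕ →. ℕ :=
  fun n => Part.bind (Encodable.decode (α := α) n) fun a => (f a).map Encodable.encode

end SepMax

/-! Membership in `∅''` is a `Σ₂` condition, and every `Σ₂` condition can be put in the form "the
set `{s | R e s}` is finite" with `R` primitive recursive (`exists_jump_jump_empty_iff_finite`). So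
it suffices to decide finiteness of such sets with oracle `f`.

Code a set by a ladder: two rays, joined by a rung at height `0` and at each height in the set. At
most two ends are possible, so `f` must answer on every ladder. If the set is finite, deleting all
rungs shows that there are two ends; a separating edge set then has to reach past every rung, since
one rung beyond it would join the two tails (`lt_of_mem_sepmax_ladder`). Hence the answer of `f`
gives a number `b e` bounding the set whenever the set is finite
(`FindsSepmax.exists_recursiveIn_bound`).

What remains is whether some `s > b e` satisfies `R e s`, an unbounded search. It is decided by a
second call of `f`, on the ladder whose only rung besides the one at `0` sits at the least such `s`,
if there is one: this set is always finite, so the new bound makes the search bounded. -/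

namespace SepMax

open Nat.Partrec (Code)
open Encodable Denumerable

/-! ### Replacing the oracle by a program -/

/-- Replaces the oracle instruction by a program. -/
def OracleCode.subst (o : Code) : OracleCode → Code
  | .zero => .zero
  | .succ => .succ
  | .left => .left
  | .right => .right
  | .oracle => o
  | .pair a b => .pair (a.subst o) (b.subst o)
  | .comp a b => .comp (a.subst o) (b.subst o)
  | .prec a b => .prec (a.subst o) (b.subst o)
  -- `rfind'` starts its search at the second component of the input, hence the pairing with `0`.
  | .rfind a => .comp (.rfind' (a.subst o)) (.pair .id .zero)

theorem OracleCode.eval_subst (o : Code) (c : OracleCode) :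
    (c.subst o).eval = c.eval o.eval := by
  induction c with
  | zero => rfl
  | succ => rfl
  | left => rfl
  | right => rfl
  | oracle => rfl
  | pair a b iha ihb =>
    simp only [subst, Code.eval, OracleCode.eval, iha, ihb]
    rfl
  | comp a b iha ihb =>
    simp only [subst, Code.eval, OracleCode.eval, iha, ihb]
    rfl
  | prec a b iha ihb =>
    simp only [subst, Code.eval, OracleCode.eval, iha, ihb]
    rfl
  | rfind a ih =>
    funext n
    simp only [subst, Code.eval, OracleCode.eval, ih, Code.eval_id]
    simp [Seq.seq, Nat.unpaired, pure, PFun.pure, Part.map_id']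

/-- One step of the course-of-values recursion computing `(OracleCode.ofNat n).subst o`. -/
def substStep (o : Code) (L : List Code) : Option Code :=
  if L.length = 0 then some .zero
  else if L.length = 1 then some .succ
  else if L.length = 2 then some .left
  else if L.length = 3 then some .right
  else if L.length = 4 then some o
  else if (L.length - 5) % 4 = 3 then
    L[(L.length - 5) / 4]?.map fun a => .comp (.rfind' a) (.pair .id .zero)
  else
    L[((L.length - 5) / 4).unpair.1]?.bind fun a =>
      L[((L.length - 5) / 4).unpair.2]?.map fun b =>
        if (L.length - 5) % 4 = 0 then .pair a b
        else if (L.length - 5) % 4 = 1 then .comp a b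
        else .prec a b

theorem primrec₂_substStep : Primrec₂ substStep := by
  have hl : Primrec fun p : Code × List Code => p.2.length :=
    Primrec.list_length.comp Primrec.snd
  have hm : Primrec fun p : Code × List Code => (p.2.length - 5) % 4 :=
    Primrec.nat_mod.comp (Primrec.nat_sub.comp hl (Primrec.const 5)) (Primrec.const 4)
  have hd : Primrec fun p : Code × List Code => (p.2.length - 5) / 4 :=
    Primrec.nat_div.comp (Primrec.nat_sub.comp hl (Primrec.const 5)) (Primrec.const 4)
  have hu := Primrec.unpair.comp hd
  have heq : ∀ (f : Code × List Code → ℕ) (_ : Primrec f) (k : ℕ),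
      PrimrecPred fun p => f p = k :=
    fun f hf k => Primrec.eq.comp hf (Primrec.const k)
  refine Primrec.ite (heq _ hl 0) (Primrec.const _) <|
    Primrec.ite (heq _ hl 1) (Primrec.const _) <|
    Primrec.ite (heq _ hl 2) (Primrec.const _) <|
    Primrec.ite (heq _ hl 3) (Primrec.const _) <|
    Primrec.ite (heq _ hl 4) (Primrec.option_some.comp Primrec.fst) <|
    Primrec.ite (heq _ hm 3) ?_ ?_
  · refine Primrec.option_map (Primrec.list_getElem?.comp Primrec.snd hd) ?_
    exact Code.primrec₂_comp.comp (Code.primrec_rfind'.comp Primrec.snd) (Primrec.const _)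
  · refine Primrec.option_bind (Primrec.list_getElem?.comp Primrec.snd (Primrec.fst.comp hu)) ?_
    refine Primrec.option_map (Primrec.list_getElem?.comp (Primrec.snd.comp Primrec.fst)
      (Primrec.snd.comp (hu.comp Primrec.fst))) ?_
    have hm' : Primrec fun p : ((Code × List Code) × Code) × Code =>
        (p.1.1.2.length - 5) % 4 := hm.comp (Primrec.fst.comp Primrec.fst)
    have ha : Primrec fun p : ((Code × List Code) × Code) × Code => p.1.2 :=
      Primrec.snd.comp Primrec.fst
    exact Primrec.ite (Primrec.eq.comp hm' (Primrec.const 0))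
      (Code.primrec₂_pair.comp ha Primrec.snd) <|
      Primrec.ite (Primrec.eq.comp hm' (Primrec.const 1))
      (Code.primrec₂_comp.comp ha Primrec.snd) (Code.primrec₂_prec.comp ha Primrec.snd)

/-- The sub-programs of the `n`-th oracle program have indices below `n`, so course-of-values
recursion applies. Uniformity in both arguments is what later makes the matrix of the `Σ₂` form
primitive recursive. -/
theorem primrec₂_subst_ofNat : Primrec₂ fun (o : Code) (n : ℕ) => (OracleCode.ofNat n).subst o := by
  refine Primrec.nat_strong_rec _ primrec₂_substStep fun o n => ?_
  match n with
  | 0 | 1 | 2 | 3 | 4 => simp [substStep, OracleCode.ofNat, OracleCode.subst]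
  | n + 5 =>
    have h : n / 4 < n + 5 := by omega
    have h₁ : (n / 4).unpair.1 < n + 5 := lt_of_le_of_lt (Nat.unpair_left_le _) h
    have h₂ : (n / 4).unpair.2 < n + 5 := lt_of_le_of_lt (Nat.unpair_right_le _) h
    have hm : n % 4 < 4 := Nat.mod_lt _ (by norm_num)
    rw [OracleCode.ofNat]
    generalize hr : n % 4 = r at hm
    interval_cases r <;>
      simp [substStep, hr, h, h₁, h₂, OracleCode.subst]

/-! ### The use principle -/

/-- The restriction of an oracle to the numbers less than `k`. -/
def cutOracle (g : ℕ →. ℕ) (k : ℕ) : ℕ →. ℕ := fun n => if n < k then g n else Part.none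

theorem cutOracle_mono (g : ℕ →. ℕ) {k l : ℕ} (h : k ≤ l) {n v : ℕ} (hv : v ∈ cutOracle g k n) :
    v ∈ cutOracle g l n := by
  unfold cutOracle at *
  split_ifs at hv with h'
  · rwa [if_pos (h'.trans_le h)]
  · exact absurd hv (Part.notMem_none _)

theorem mem_of_mem_cutOracle (g : ℕ →. ℕ) {k n v : ℕ} (hv : v ∈ cutOracle g k n) : v ∈ g n := by
  unfold cutOracle at hv
  split_ifs at hv with h'
  · exact hv
  · exact absurd hv (Part.notMem_none _)

theorem OracleCode.mem_eval_pair {g : ℕ →. ℕ} {a b : OracleCode} {n v : ℕ} :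
    v ∈ (pair a b).eval g n ↔ ∃ x ∈ a.eval g n, ∃ y ∈ b.eval g n, Nat.pair x y = v := by
  simp [eval, Seq.seq]

theorem OracleCode.mem_eval_rfind {g : ℕ →. ℕ} {a : OracleCode} {n v : ℕ} :
    v ∈ (rfind a).eval g n ↔
      0 ∈ a.eval g (Nat.pair n v) ∧ ∀ m < v, ∃ y ∈ a.eval g (Nat.pair n m), y ≠ 0 := by
  refine Nat.mem_rfind.trans ?_
  simp

theorem OracleCode.mem_eval_prec_zero {g : ℕ →. ℕ} {a b : OracleCode} {n v : ℕ} :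
    v ∈ (prec a b).eval g (Nat.pair n 0) ↔ v ∈ a.eval g n := by
  simp [eval]

theorem OracleCode.mem_eval_prec_succ {g : ℕ →. ℕ} {a b : OracleCode} {n y v : ℕ} :
    v ∈ (prec a b).eval g (Nat.pair n (y + 1)) ↔
      ∃ w ∈ (prec a b).eval g (Nat.pair n y), v ∈ b.eval g (Nat.pair n (Nat.pair y w)) := by
  simp [eval]

theorem OracleCode.eval_mono {g h : ℕ →. ℕ} (hgh : ∀ n, ∀ v ∈ g n, v ∈ h n) (c : OracleCode) :
    ∀ n, ∀ v ∈ c.eval g n, v ∈ c.eval h n := by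
  induction c with
  | zero | succ | left | right => exact fun _ _ => id
  | oracle => exact hgh
  | pair a b iha ihb =>
    intro n v hv
    obtain ⟨x, hx, y, hy, rfl⟩ := mem_eval_pair.1 hv
    exact mem_eval_pair.2 ⟨x, iha _ _ hx, y, ihb _ _ hy, rfl⟩
  | comp a b iha ihb =>
    intro n v hv
    obtain ⟨w, hw, hv⟩ := Part.mem_bind_iff.1 hv
    exact Part.mem_bind_iff.2 ⟨w, ihb _ _ hw, iha _ _ hv⟩
  | prec a b iha ihb =>
    intro n
    obtain ⟨⟨m, y⟩, rfl⟩ := Nat.pairEquiv.surjective n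
    simp only [Nat.pairEquiv_apply, Function.uncurry_apply_pair]
    induction y with
    | zero => exact fun v hv => mem_eval_prec_zero.2 (iha _ _ (mem_eval_prec_zero.1 hv))
    | succ y ih =>
      intro v hv
      obtain ⟨w, hw, hv⟩ := mem_eval_prec_succ.1 hv
      exact mem_eval_prec_succ.2 ⟨w, ih _ hw, ihb _ _ hv⟩
  | rfind a ih =>
    intro n v hv
    obtain ⟨h0, hlt⟩ := mem_eval_rfind.1 hv
    exact mem_eval_rfind.2 ⟨ih _ _ h0, fun m hm =>
      let ⟨y, hy, hy0⟩ := hlt m hm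
      ⟨y, ih _ _ hy, hy0⟩⟩

theorem OracleCode.eval_cutOracle_mono {g : ℕ →. ℕ} {c : OracleCode} {k l n v : ℕ} (h : k ≤ l)
    (hv : v ∈ c.eval (cutOracle g k) n) : v ∈ c.eval (cutOracle g l) n :=
  c.eval_mono (fun _ _ => cutOracle_mono g h) _ _ hv

/-- A halting computation makes only finitely many queries. -/
theorem OracleCode.exists_mem_eval_cutOracle (g : ℕ →. ℕ) (c : OracleCode) :
    ∀ n, ∀ v ∈ c.eval g n, ∃ k, v ∈ c.eval (cutOracle g k) n := by
  induction c with
  | zero | succ | left | right => exact fun _ _ h => ⟨0, h⟩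
  | oracle =>
    intro n v hv
    refine ⟨n + 1, ?_⟩
    simpa [eval, cutOracle] using hv
  | pair a b iha ihb =>
    intro n v hv
    obtain ⟨x, hx, y, hy, rfl⟩ := mem_eval_pair.1 hv
    obtain ⟨k, hk⟩ := iha _ _ hx
    obtain ⟨l, hl⟩ := ihb _ _ hy
    exact ⟨max k l, mem_eval_pair.2 ⟨x, eval_cutOracle_mono (le_max_left _ _) hk, y,
      eval_cutOracle_mono (le_max_right _ _) hl, rfl⟩⟩
  | comp a b iha ihb =>
    intro n v hv
    obtain ⟨w, hw, hv⟩ := Part.mem_bind_iff.1 hv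
    obtain ⟨k, hk⟩ := ihb _ _ hw
    obtain ⟨l, hl⟩ := iha _ _ hv
    exact ⟨max k l, Part.mem_bind_iff.2 ⟨w, eval_cutOracle_mono (le_max_left _ _) hk,
      eval_cutOracle_mono (le_max_right _ _) hl⟩⟩
  | prec a b iha ihb =>
    intro n
    obtain ⟨⟨m, y⟩, rfl⟩ := Nat.pairEquiv.surjective n
    simp only [Nat.pairEquiv_apply, Function.uncurry_apply_pair]
    induction y with
    | zero =>
      intro v hv
      obtain ⟨k, hk⟩ := iha _ _ (mem_eval_prec_zero.1 hv)
      exact ⟨k, mem_eval_prec_zero.2 hk⟩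
    | succ y ih =>
      intro v hv
      obtain ⟨w, hw, hv⟩ := mem_eval_prec_succ.1 hv
      obtain ⟨k, hk⟩ := ih _ hw
      obtain ⟨l, hl⟩ := ihb _ _ hv
      exact ⟨max k l, mem_eval_prec_succ.2 ⟨w, eval_cutOracle_mono (le_max_left _ _) hk,
        eval_cutOracle_mono (le_max_right _ _) hl⟩⟩
  | rfind a ih =>
    intro n v hv
    obtain ⟨h0, hlt⟩ := mem_eval_rfind.1 hv
    obtain ⟨k, hk⟩ := ih _ _ h0
    have hb : ∀ m : Fin v, ∃ l, ∃ y ∈ a.eval (cutOracle g l) (Nat.pair n m), y ≠ 0 := fun m =>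
      let ⟨y, hy, hy0⟩ := hlt m m.2
      let ⟨l, hl⟩ := ih _ _ hy
      ⟨l, y, hl, hy0⟩
    choose l hl using hb
    refine ⟨max k (Finset.univ.sup l), mem_eval_rfind.2
      ⟨eval_cutOracle_mono (le_max_left _ _) hk, fun m hm => ?_⟩⟩
    obtain ⟨y, hy, hy0⟩ := hl ⟨m, hm⟩
    exact ⟨y, eval_cutOracle_mono
      ((Finset.le_sup (f := l) (Finset.mem_univ _)).trans (le_max_right _ _)) hy, hy0⟩


/-! ### The second jump of the empty set is `Σ₂` -/

theorem dom_eval_iff_exists_evaln {c : Code} {n : ℕ} :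
    (c.eval n).Dom ↔ ∃ k, (c.evaln k n).isSome := by
  simp only [Part.dom_iff_mem, Code.evaln_complete, Option.isSome_iff_exists, Option.mem_def]
  exact exists_comm

/-- The `n`-th oracle program with empty oracle halts within `t` steps. -/
def HaltsWithin (t n : ℕ) : Prop :=
  (Code.evaln t ((OracleCode.ofNat n).subst .zero) 0).isSome

theorem primrecRel_haltsWithin : PrimrecRel HaltsWithin := by
  have h : Primrec fun p : ℕ × ℕ => Code.evaln p.1 ((OracleCode.ofNat p.2).subst .zero) 0 :=
    Code.primrec_evaln.comp <| (Primrec.fst.pair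
      (primrec₂_subst_ofNat.comp (Primrec.const _) Primrec.snd)).pair (Primrec.const 0)
  exact (Primrec.eq.comp (Primrec.option_isSome.comp h) (Primrec.const true)).of_eq
    fun _ => Iff.rfl

theorem HaltsWithin.mono {s t n : ℕ} (h : HaltsWithin s n) (hst : s ≤ t) : HaltsWithin t n := by
  obtain ⟨v, hv⟩ := Option.isSome_iff_exists.1 h
  exact Option.isSome_iff_exists.2 ⟨v, Code.evaln_mono hst hv⟩

theorem mem_jump_empty {n : ℕ} : n ∈ jump ∅ ↔ ∃ t, HaltsWithin t n := by
  have h : setOracle ∅ = Code.zero.eval := by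
    funext n
    simp [setOracle, charFn, Code.eval, pure, PFun.pure]
  rw [jump, Set.mem_ofPred_eq, h, ← OracleCode.eval_subst, dom_eval_iff_exists_evaln]
  rfl

/-- Only finitely many programs below `k` halt, so the stages approximating the jump settle on this
initial segment. -/
theorem exists_forall_haltsWithin (k : ℕ) : ∃ t, ∀ n < k, n ∈ jump ∅ → HaltsWithin t n := by
  have h : ∀ n, ∃ t, n ∈ jump ∅ → HaltsWithin t n := fun n => by
    by_cases hn : n ∈ jump ∅
    · exact (mem_jump_empty.1 hn).imp fun _ h _ => h
    · exact ⟨0, fun h => absurd h hn⟩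
  choose t ht using h
  exact ⟨(Finset.range k).sup t, fun n hn hj =>
    (ht n hj).mono (Finset.le_sup (Finset.mem_range.2 hn))⟩

open Classical in
/-- There is a program which, given `t` and `k`, computes on the numbers `n < k` whether the
`n`-th oracle program with empty oracle halts within `t` steps. -/
theorem exists_code_haltsWithin : ∃ c : Code, ∀ t k n, c.eval (Nat.pair (Nat.pair t k) n) =
    if n < k then Part.some (if HaltsWithin t n then 1 else 0) else Part.none := by
  have h₁ : Primrec fun p : ℕ => p.unpair.1 := Primrec.fst.comp Primrec.unpair
  have h₂ : Primrec fun p : ℕ => p.unpair.2 := Primrec.snd.comp Primrec.unpair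
  have h : Primrec fun p : ℕ => if p.unpair.2 < p.unpair.1.unpair.2 then
      some (if HaltsWithin p.unpair.1.unpair.1 p.unpair.2 then 1 else 0) else none :=
    Primrec.ite (Primrec.nat_lt.comp h₂ (h₂.comp h₁))
      (Primrec.option_some.comp (Primrec.ite (primrecRel_haltsWithin.comp (h₁.comp h₁) h₂)
        (Primrec.const 1) (Primrec.const 0))) (Primrec.const none)
  obtain ⟨c, hc⟩ := Code.exists_code.1 (Partrec.nat_iff.1 h.to_comp.ofOption)
  refine ⟨c, fun t k n => ?_⟩
  rw [hc]
  simp only [Nat.unpair_pair]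
  split_ifs <;> rfl

/-- By the use principle, a halting computation with oracle `∅'` is witnessed by a use bound `k`, a
stage `t` at which `∅'` has settled below `k`, and a number of steps `j` for the run on that finite
approximation. Only "has settled" needs a universal quantifier: no `n < k` halts at a stage `y`
without having halted by `t`. -/
theorem jump_jump_empty_sigma_two : ∃ Q : ℕ × ℕ → ℕ → Prop, PrimrecRel Q ∧
    ∀ e, e ∈ jump (jump ∅) ↔ ∃ x, ∀ y, Q (e, x) y := by
  classical
  obtain ⟨c, hc⟩ := exists_code_haltsWithin
  have hcut : ∀ {t k}, (∀ n < k, n ∈ jump ∅ → HaltsWithin t n) →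
      (c.curry (Nat.pair t k)).eval = cutOracle (setOracle (jump ∅)) k := by
    intro t k h
    funext n
    rw [Code.eval_curry, hc, cutOracle]
    by_cases hn : n < k
    · have hiff : HaltsWithin t n ↔ n ∈ jump ∅ :=
        ⟨fun ht => mem_jump_empty.2 ⟨t, ht⟩, h n hn⟩
      simp only [hn, setOracle, charFn, hiff]
    · simp only [hn, if_false]
  -- The witness `p.2` codes `((t, k), j)`.
  refine ⟨fun p y =>
    (Code.evaln p.2.unpair.2 ((OracleCode.ofNat p.1).subst (c.curry p.2.unpair.1)) 0).isSome ∧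
      ∀ n < p.2.unpair.1.unpair.2, HaltsWithin y n → HaltsWithin p.2.unpair.1.unpair.1 n,
    ?_, fun e => ⟨fun he => ?_, ?_⟩⟩
  · have hx : Primrec fun q : (ℕ × ℕ) × ℕ => q.1.2.unpair :=
      Primrec.unpair.comp (Primrec.snd.comp Primrec.fst)
    have hx₁ := Primrec.fst.comp hx
    have hu := Primrec.unpair.comp hx₁
    have hev : Primrec fun q : (ℕ × ℕ) × ℕ => Code.evaln q.1.2.unpair.2
        ((OracleCode.ofNat q.1.1).subst (c.curry q.1.2.unpair.1)) 0 :=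
      Code.primrec_evaln.comp <| ((Primrec.snd.comp hx).pair
        (primrec₂_subst_ofNat.comp (Code.primrec₂_curry.comp (Primrec.const c) hx₁)
          (Primrec.fst.comp Primrec.fst))).pair (Primrec.const 0)
    have himp : PrimrecRel fun (n : ℕ) (q : ℕ × ℕ) => HaltsWithin q.2 n → HaltsWithin q.1 n :=
      ((primrecRel_haltsWithin.comp (Primrec.snd.comp Primrec.snd) Primrec.fst).not.or
        (primrecRel_haltsWithin.comp (Primrec.fst.comp Primrec.snd) Primrec.fst)).of_eq
        fun _ => imp_iff_not_or.symm
    have hall : PrimrecPred fun q : (ℕ × ℕ) × ℕ => ∀ n < q.1.2.unpair.1.unpair.2,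
        HaltsWithin q.2 n → HaltsWithin q.1.2.unpair.1.unpair.1 n :=
      (himp.forall_mem_list.comp (Primrec.list_range.comp (Primrec.snd.comp hu))
        ((Primrec.fst.comp hu).pair Primrec.snd)).of_eq fun q => by simp
    exact ((Primrec.eq.comp (Primrec.option_isSome.comp hev) (Primrec.const true)).and hall)
  · obtain ⟨v, hv⟩ := Part.dom_iff_mem.1 he
    obtain ⟨k, hk⟩ := OracleCode.exists_mem_eval_cutOracle _ _ _ _ hv
    obtain ⟨t, ht⟩ := exists_forall_haltsWithin k
    rw [← hcut ht, ← OracleCode.eval_subst] at hk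
    obtain ⟨j, hj⟩ := dom_eval_iff_exists_evaln.1 (Part.dom_iff_mem.2 ⟨v, hk⟩)
    refine ⟨Nat.pair (Nat.pair t k) j, fun y => ?_⟩
    simp only [Nat.unpair_pair]
    exact ⟨hj, fun n hn hy => ht n hn (mem_jump_empty.2 ⟨y, hy⟩)⟩
  · rintro ⟨x, hx⟩
    have hd := dom_eval_iff_exists_evaln.2 ⟨_, (hx 0).1⟩
    -- The universal clause says exactly that the approximation is correct below `k`, so the run
    -- really uses a restriction of `∅'`.
    rw [← Nat.pair_unpair x.unpair.1, OracleCode.eval_subst, hcut fun n hn hj =>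
      let ⟨y, hy⟩ := mem_jump_empty.1 hj
      (hx y).2 n hn hy] at hd
    obtain ⟨v, hv⟩ := Part.dom_iff_mem.1 hd
    exact Part.dom_iff_mem.2 ⟨v, OracleCode.eval_mono
      (fun _ _ => mem_of_mem_cutOracle _) _ _ _ hv⟩

/-! ### Finiteness is `Σ₂`-complete -/

/-- Let `s` code `(x, y)`, where `y` is the least stage by which all candidates `x' ≤ x` have been
refuted. Each `x` contributes at most one `s`, and contributes one exactly when no `x' ≤ x` is a
true witness. So the set is finite if and only if a witness exists. -/
theorem exists_finite_iff_sigma_two {Q : ℕ × ℕ → ℕ → Prop} (hQ : PrimrecRel Q) :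
    ∃ R : ℕ → ℕ → Prop, PrimrecRel R ∧ ∀ e, (∃ x, ∀ y, Q (e, x) y) ↔ {s | R e s}.Finite := by
  let P : ℕ → ℕ × ℕ → Prop := fun y q => ∀ x < q.2 + 1, ∃ y' < y + 1, ¬ Q (q.1, x) y'
  have hP : PrimrecRel P := by
    have h₀ : PrimrecRel fun (y' : ℕ) (q : ℕ × ℕ) => ¬ Q q y' :=
      (hQ.comp Primrec.snd Primrec.fst).not
    have h₁ : PrimrecRel fun (x : ℕ) (q : ℕ × ℕ) => ∃ y' < q.2 + 1, ¬ Q (q.1, x) y' :=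
      (h₀.exists_mem_list.comp
        (Primrec.list_range.comp (Primrec.succ.comp (Primrec.snd.comp Primrec.snd)))
        ((Primrec.fst.comp Primrec.snd).pair Primrec.fst)).of_eq fun q => by simp
    exact (h₁.forall_mem_list.comp
        (Primrec.list_range.comp (Primrec.succ.comp (Primrec.snd.comp Primrec.snd)))
        ((Primrec.fst.comp Primrec.snd).pair Primrec.fst)).of_eq fun q => by simp [P]
  refine ⟨fun e s => P s.unpair.2 (e, s.unpair.1) ∧
    ∀ y < s.unpair.2, ¬ P y (e, s.unpair.1), ?_, fun e => ⟨?_, fun hfin => ?_⟩⟩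
  · have hu : Primrec fun q : ℕ × ℕ => q.2.unpair := Primrec.unpair.comp Primrec.snd
    have ha := Primrec.fst.pair (Primrec.fst.comp hu)
    exact (hP.comp (Primrec.snd.comp hu) ha).and
      ((hP.not.forall_mem_list.comp (Primrec.list_range.comp (Primrec.snd.comp hu)) ha).of_eq
        fun q => by simp)
  · rintro ⟨x₀, hx₀⟩
    refine Set.Finite.of_finite_image (f := fun s => s.unpair.1)
      ((Set.finite_lt_nat x₀).subset ?_) ?_
    · rintro _ ⟨s, ⟨hs, -⟩, rfl⟩
      by_contra hlt
      obtain ⟨y, -, hy⟩ := hs x₀ (Nat.lt_succ_of_le (not_lt.1 hlt))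
      exact hy (hx₀ y)
    -- Minimality of the stage makes the first coordinate injective on the set.
    · rintro s ⟨hs, hs'⟩ t ⟨ht, ht'⟩ (hst : s.unpair.1 = t.unpair.1)
      rw [hst] at hs hs'
      have h : s.unpair.2 = t.unpair.2 :=
        le_antisymm (not_lt.1 fun h => hs' _ h ht) (not_lt.1 fun h => ht' _ h hs)
      rw [← Nat.pair_unpair s, ← Nat.pair_unpair t, hst, h]
  · classical
    by_contra! hno
    have hex : ∀ x, ∃ y, P y (e, x) := fun x => by
      choose y hy using hno
      -- The latest of the refutation stages of `0, …, x`.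
      exact ⟨(Finset.range (x + 1)).sup y, fun x' hx' =>
        ⟨y x', Nat.lt_succ_of_le (Finset.le_sup (Finset.mem_range.2 hx')), hy x'⟩⟩
    refine Set.infinite_of_injective_forall_mem
      (f := fun x => Nat.pair x (Nat.find (hex x))) ?_ (fun x => ?_) hfin
    · intro x x' h
      exact (Nat.pair_eq_pair.1 h).1
    · simp only [Set.mem_ofPred_eq, Nat.unpair_pair]
      exact ⟨Nat.find_spec (hex x), fun y => Nat.find_min (hex x)⟩

theorem exists_jump_jump_empty_iff_finite : ∃ R : ℕ → ℕ → Prop, PrimrecRel R ∧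
    ∀ e, e ∈ jump (jump ∅) ↔ {s | R e s}.Finite := by
  obtain ⟨Q, hQ, hQ'⟩ := jump_jump_empty_sigma_two
  obtain ⟨R, hR, hR'⟩ := exists_finite_iff_sigma_two hQ
  exact ⟨R, hR, fun e => (hQ' e).trans (hR' e)⟩


/-! ### Ladders -/

/-- Adjacency in the ladder whose two rays consist of the even and of the odd numbers, and whose
rungs join `2 * n` and `2 * n + 1` for `n = 0` and for all `n` with `r n`. -/
def LadderAdj (r : ℕ → Prop) (u v : ℕ) : Prop :=
  v = u + 2 ∨ u = v + 2 ∨ (u / 2 = v / 2 ∧ u ≠ v ∧ (u / 2 = 0 ∨ r (u / 2)))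

/-- The ladder with a rung at height `0` and at every height satisfying `r`. -/
def ladder (r : ℕ → Prop) : SimpleGraph (Set.univ : Set ℕ) where
  Adj x y := LadderAdj r x y
  symm := ⟨by
    rintro x y (h | h | ⟨h₁, h₂, h₃⟩)
    · exact Or.inr (Or.inl h)
    · exact Or.inl h
    · exact Or.inr (Or.inr ⟨h₁.symm, h₂.symm, h₁ ▸ h₃⟩)⟩
  loopless := ⟨by
    rintro x (h | h | ⟨-, h, -⟩)
    · omega
    · omega
    · exact h rfl⟩

/-- A natural number as a vertex of a ladder. -/
def vtx (n : ℕ) : (Set.univ : Set ℕ) := ⟨n, trivial⟩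

@[simp] theorem coe_vtx (n : ℕ) : (vtx n : ℕ) = n := rfl

theorem vtx_injective : Function.Injective vtx := fun _ _ h => congrArg Subtype.val h

theorem ladder_adj_vtx {r : ℕ → Prop} {u v : ℕ} :
    (ladder r).Adj (vtx u) (vtx v) ↔ LadderAdj r u v := Iff.rfl

/-- The rung at height `0` is present in every ladder for this purpose. -/
theorem ladder_connected (r : ℕ → Prop) : (ladder r).Connected := by
  have h : ∀ n, (ladder r).Reachable (vtx 0) (vtx n) := fun n => by
    induction n using Nat.strong_induction_on with
    | _ n ih =>
      match n with
      | 0 => exact .rfl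
      | 1 =>
        exact SimpleGraph.Adj.reachable (ladder_adj_vtx.2 (Or.inr (Or.inr (by simp))))
      | n + 2 =>
        exact (ih n (by omega)).trans
          (SimpleGraph.Adj.reachable (ladder_adj_vtx.2 (Or.inl rfl)))
  exact ⟨fun x y => (h x).symm.trans (h y)⟩

/-- All end-vertices of the edges in `E` are less than `K`. -/
def EdgesBelow (E : Finset (Sym2 (Set.univ : Set ℕ))) (K : ℕ) : Prop :=
  ∀ e ∈ E, ∀ x ∈ e, (x : ℕ) < K

theorem exists_edgesBelow (E : Finset (Sym2 (Set.univ : Set ℕ))) : ∃ K, EdgesBelow E K := by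
  have h : ∀ e : Sym2 (Set.univ : Set ℕ), ∃ K, ∀ x ∈ e, (x : ℕ) < K := fun e => by
    induction e with
    | _ x y => exact ⟨x + y + 1, fun z hz => by rcases Sym2.mem_iff.1 hz with rfl | rfl <;> omega⟩
  choose K hK using h
  exact ⟨E.sup K, fun e he x hx => (hK e x hx).trans_le (Finset.le_sup he)⟩

variable {r : ℕ → Prop} {E : Finset (Sym2 (Set.univ : Set ℕ))} {K : ℕ}

theorem EdgesBelow.adj (hE : EdgesBelow E K) {u v : ℕ} (hu : K ≤ u) (h : LadderAdj r u v) :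
    ((ladder r).deleteEdges (E : Set (Sym2 (Set.univ : Set ℕ)))).Adj (vtx u) (vtx v) := by
  rw [SimpleGraph.deleteEdges_adj]
  exact ⟨h, fun he => hu.not_gt (hE _ he (vtx u) (Sym2.mem_mk_left _ _))⟩

theorem EdgesBelow.reachable (hE : EdgesBelow E K) {u : ℕ} (hu : K ≤ u) (j : ℕ) :
    ((ladder r).deleteEdges (E : Set (Sym2 (Set.univ : Set ℕ)))).Reachable
      (vtx u) (vtx (u + 2 * j)) := by
  induction j with
  | zero => exact .rfl
  | succ j ih =>
    exact ih.trans (hE.adj (by omega) (Or.inl (by ring))).reachable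

theorem EdgesBelow.reachable_of_mod_two_eq (hE : EdgesBelow E K) {u v : ℕ} (hu : K ≤ u)
    (hv : K ≤ v) (h : u % 2 = v % 2) :
    ((ladder r).deleteEdges (E : Set (Sym2 (Set.univ : Set ℕ)))).Reachable (vtx u) (vtx v) := by
  rcases le_total u v with huv | huv
  · obtain ⟨j, rfl⟩ : ∃ j, v = u + 2 * j := ⟨(v - u) / 2, by omega⟩
    exact hE.reachable hu j
  · obtain ⟨j, rfl⟩ : ∃ j, u = v + 2 * j := ⟨(u - v) / 2, by omega⟩
    exact (hE.reachable hv j).symm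

theorem exists_le_mem_supp {G : SimpleGraph (Set.univ : Set ℕ)} {C : G.ConnectedComponent}
    (hC : C.supp.Infinite) (K : ℕ) : ∃ v, K ≤ v ∧ G.connectedComponentMk (vtx v) = C := by
  by_contra! h
  refine hC (((Set.finite_lt_nat K).image vtx).subset fun x hx => ⟨x, ?_, rfl⟩)
  exact not_le.1 fun hle => h x hle hx

/-- Beyond the end-vertices of `E` both rays are intact, so an infinite component contains the even
tail or the odd tail. -/
theorem numInfComp_ladder_le_two (r : ℕ → Prop) (E : Finset (Sym2 (Set.univ : Set ℕ))) :
    numInfComp (ladder r) E ≤ 2 := by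
  obtain ⟨K, hE⟩ := exists_edgesBelow E
  set G := (ladder r).deleteEdges (E : Set (Sym2 (Set.univ : Set ℕ)))
  have hpair : ({G.connectedComponentMk (vtx (2 * K)),
      G.connectedComponentMk (vtx (2 * K + 1))} : Set G.ConnectedComponent).encard ≤ 2 :=
    (Set.encard_insert_le _ _).trans (by rw [Set.encard_singleton, one_add_one_eq_two])
  refine (Set.encard_le_encard (fun C hC => ?_)).trans hpair
  obtain ⟨v, hv, rfl⟩ := exists_le_mem_supp hC K
  rcases Nat.mod_two_eq_zero_or_one v with h | h
  · exact Or.inl (SimpleGraph.ConnectedComponent.eq.2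
      (hE.reachable_of_mod_two_eq hv (by omega) (by omega)))
  · exact Or.inr (SimpleGraph.ConnectedComponent.eq.2
      (hE.reachable_of_mod_two_eq hv (by omega) (by omega)))

theorem numEnds_ladder_ne_top (r : ℕ → Prop) : numEnds (ladder r) ≠ ⊤ :=
  ne_top_of_le_ne_top (by decide : (2 : ℕ∞) ≠ ⊤)
    (iSup₂_le fun E _ => numInfComp_ladder_le_two r E)

/-- A rung beyond `E` survives the deletion and joins the two tails. -/
theorem numInfComp_ladder_le_one (hE : EdgesBelow E K) {n : ℕ} (hn : K ≤ 2 * n) (hr : r n) :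
    numInfComp (ladder r) E ≤ 1 := by
  have h : ∀ v, K ≤ v → ((ladder r).deleteEdges (E : Set (Sym2 (Set.univ : Set ℕ)))).Reachable
      (vtx v) (vtx (2 * n)) := fun v hv => by
    rcases Nat.mod_two_eq_zero_or_one v with h | h
    · exact hE.reachable_of_mod_two_eq hv hn (by omega)
    · refine (hE.reachable_of_mod_two_eq hv (v := 2 * n + 1) (by omega) (by omega)).trans ?_
      refine (hE.adj hn (Or.inr (Or.inr ⟨by omega, by omega, Or.inr ?_⟩))).symm.reachable
      rwa [Nat.mul_div_cancel_left _ two_pos]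
  refine Set.encard_le_one_iff.2 fun C D hC hD => ?_
  obtain ⟨u, hu, rfl⟩ := exists_le_mem_supp hC K
  obtain ⟨v, hv, rfl⟩ := exists_le_mem_supp hD K
  exact SimpleGraph.ConnectedComponent.eq.2 ((h u hu).trans (h v hv).symm)

theorem two_le_numEnds_ladder (hr : {n | r n}.Finite) : 2 ≤ numEnds (ladder r) := by
  classical
  -- The permanent rung at height `0` has to be cut as well.
  have hfin : {n | n = 0 ∨ r n}.Finite := (Set.finite_singleton 0).union hr
  set E : Finset (Sym2 (Set.univ : Set ℕ)) :=
    hfin.toFinset.image fun n => s(vtx (2 * n), vtx (2 * n + 1)) with hE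
  have hmem : ∀ {u v : ℕ}, s(vtx u, vtx v) ∈ E ↔ ∃ n, (n = 0 ∨ r n) ∧
      ((2 * n = u ∧ 2 * n + 1 = v) ∨ (2 * n = v ∧ 2 * n + 1 = u)) := by
    simp [hE, vtx_injective.eq_iff]
  have hsub : (E : Set (Sym2 (Set.univ : Set ℕ))) ⊆ (ladder r).edgeSet := by
    intro e he
    obtain ⟨n, hn, rfl⟩ := Finset.mem_image.1 he
    refine ladder_adj_vtx.2 (Or.inr (Or.inr ⟨by omega, by omega, ?_⟩))
    rw [Nat.mul_div_cancel_left _ two_pos]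
    simpa using hn
  set G := (ladder r).deleteEdges (E : Set (Sym2 (Set.univ : Set ℕ))) with hG
  -- Without rungs, parity is invariant along edges, which keeps the two rays apart.
  have hadj : ∀ {u v}, G.Adj (vtx u) (vtx v) → u % 2 = v % 2 := by
    intro u v h
    rw [hG, SimpleGraph.deleteEdges_adj, Finset.mem_coe, hmem] at h
    obtain ⟨h | h | ⟨h₁, h₂, h₃⟩, h'⟩ := h
    · simp only [coe_vtx] at h
      omega
    · simp only [coe_vtx] at h
      omega
    · simp only [coe_vtx] at h₁ h₂ h₃
      exact absurd ⟨u / 2, h₃, by omega⟩ h'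
  have hreach : ∀ {x y : (Set.univ : Set ℕ)}, G.Reachable x y → (x : ℕ) % 2 = y % 2 := by
    rintro x y ⟨p⟩
    induction p with
    | nil => rfl
    | cons h _ ih => exact (hadj h).trans ih
  have hray : ∀ u j : ℕ, G.Reachable (vtx u) (vtx (u + 2 * j)) := by
    intro u j
    induction j with
    | zero => exact .rfl
    | succ j ih =>
      refine ih.trans (SimpleGraph.Adj.reachable ?_)
      rw [hG, SimpleGraph.deleteEdges_adj, Finset.mem_coe, hmem]
      exact ⟨Or.inl (by simp only [coe_vtx]; ring), fun ⟨n, _, h⟩ => by omega⟩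
  have hinf : ∀ u, (G.connectedComponentMk (vtx u)).supp.Infinite := fun u =>
    Set.infinite_of_injective_forall_mem (f := fun j => vtx (u + 2 * j))
      (fun i j h => by have := vtx_injective h; omega)
      fun j => SimpleGraph.ConnectedComponent.eq.2 (hray u j).symm
  have hne : G.connectedComponentMk (vtx 0) ≠ G.connectedComponentMk (vtx 1) := fun h => by
    have := hreach (SimpleGraph.ConnectedComponent.eq.1 h)
    simp at this
  calc (2 : ℕ∞) = Set.encard {G.connectedComponentMk (vtx 0), G.connectedComponentMk (vtx 1)} :=
        (Set.encard_pair hne).symm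
    _ ≤ numInfComp (ladder r) E := Set.encard_le_encard <| by
        rintro C (rfl | rfl)
        exacts [hinf 0, hinf 1]
    _ ≤ numEnds (ladder r) := le_iSup₂_of_le E hsub le_rfl

/-- An edge set separating the ends of a ladder with finitely many rungs reaches beyond all
rungs. -/
theorem lt_of_mem_sepmax_ladder (hr : {n | r n}.Finite) (hE : E ∈ sepmax (ladder r))
    (hK : EdgesBelow E K) {n : ℕ} (hn : r n) : 2 * n < K := by
  by_contra! h
  have h₁ := (two_le_numEnds_ladder hr).trans (hE.2 ▸ numInfComp_ladder_le_one hK h hn)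
  exact absurd h₁ (by decide)

open Classical in
-- The three summands count the upper neighbour, the lower one (absent at height `0`) and the
-- partner across a rung. This gives local finiteness and a computable degree formula at once.
theorem image_vtx_neighbors (r : ℕ → Prop) (v : ℕ) :
    ∃ S : Finset ℕ, (ladder r).neighborSet (vtx v) = vtx '' S ∧
      S.card = 1 + (if v < 2 then 0 else 1) + (if v / 2 = 0 ∨ r (v / 2) then 1 else 0) := by
  have key : ∀ S : Finset ℕ, (∀ w, LadderAdj r v w ↔ w ∈ S) →
      (ladder r).neighborSet (vtx v) = vtx '' S := fun S hS => by
    ext x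
    exact ⟨fun hx => ⟨x, (hS x).1 hx, rfl⟩, fun ⟨w, hw, hx⟩ => hx ▸ (hS w).2 hw⟩
  set mate := if v % 2 = 0 then v + 1 else v - 1 with hmate
  have hm : ∀ w, v / 2 = w / 2 ∧ v ≠ w ↔ w = mate := fun w => by
    rw [hmate]
    split_ifs <;> omega
  have hm' := (hm mate).2 rfl
  by_cases h₁ : v < 2 <;> by_cases h₂ : v / 2 = 0 ∨ r (v / 2)
  · refine ⟨{v + 2, mate}, key _ fun w => ?_, ?_⟩
    · rw [LadderAdj, ← and_assoc, hm, and_iff_left h₂]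
      simp
      omega
    · rw [if_pos h₁, if_pos h₂, Finset.card_pair (by omega)]
  -- Impossible case: `v < 2` means height `0`, where there is a rung.
  · omega
  · refine ⟨{v + 2, v - 2, mate}, key _ fun w => ?_, ?_⟩
    · rw [LadderAdj, ← and_assoc, hm, and_iff_left h₂]
      simp
      omega
    · rw [if_neg h₁, if_pos h₂, Finset.card_eq_three.2
        ⟨_, _, _, by omega, by omega, by omega, rfl⟩]
  · refine ⟨{v + 2, v - 2}, key _ fun w => ?_, ?_⟩
    · rw [LadderAdj, ← and_assoc, hm, iff_false_intro h₂, and_false, or_false]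
      simp
      omega
    · rw [if_neg h₁, if_neg h₂, Finset.card_pair (by omega)]


/-! ### Descriptions of ladders -/

theorem primrecPred_ladderAdj {R : ℕ → ℕ → Prop} (hR : PrimrecRel R) {α : Type*} [Primcodable α]
    {a u v : α → ℕ} (ha : Primrec a) (hu : Primrec u) (hv : Primrec v) :
    PrimrecPred fun x => LadderAdj (R (a x)) (u x) (v x) := by
  have h2 : ∀ {w : α → ℕ}, Primrec w → Primrec fun x => w x / 2 :=
    fun hw => Primrec.nat_div.comp hw (Primrec.const 2)
  have hs : ∀ {w : α → ℕ}, Primrec w → Primrec fun x => w x + 2 :=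
    fun hw => Primrec.nat_add.comp hw (Primrec.const 2)
  exact (Primrec.eq.comp hv (hs hu)).or <| (Primrec.eq.comp hu (hs hv)).or <|
    (Primrec.eq.comp (h2 hu) (h2 hv)).and <| (Primrec.eq.comp hu hv).not.and <|
      (Primrec.eq.comp (h2 hu) (Primrec.const 0)).or (hR.comp ha (h2 hu))

/-- Descriptions of the ladders with rungs in a uniformly primitive recursive family of sets can
be computed uniformly. -/
theorem exists_computable_describes_ladder {R : ℕ → ℕ → Prop} (hR : PrimrecRel R) :
    ∃ d : ℕ → GraphCode, Computable d ∧ ∀ a, Describes (d a) Set.univ (ladder (R a)) := by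
  classical
  have h₁ : Primrec fun p : ℕ => p.unpair.1 := Primrec.fst.comp Primrec.unpair
  have h₂ : Primrec fun p : ℕ => p.unpair.2 := Primrec.snd.comp Primrec.unpair
  have hadj : Primrec fun p : ℕ =>
      if LadderAdj (R p.unpair.1) p.unpair.2.unpair.1 p.unpair.2.unpair.2 then 1 else 0 :=
    Primrec.ite (primrecPred_ladderAdj hR h₁ (h₁.comp h₂) (h₂.comp h₂))
      (Primrec.const 1) (Primrec.const 0)
  have hhalf : Primrec fun p : ℕ => p.unpair.2 / 2 := Primrec.nat_div.comp h₂ (Primrec.const 2)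
  have hdeg : Primrec fun p : ℕ => 1 + (if p.unpair.2 < 2 then 0 else 1) +
      (if p.unpair.2 / 2 = 0 ∨ R p.unpair.1 (p.unpair.2 / 2) then 1 else 0) :=
    Primrec.nat_add.comp (Primrec.nat_add.comp (Primrec.const 1)
      (Primrec.ite (Primrec.nat_lt.comp h₂ (Primrec.const 2)) (Primrec.const 0) (Primrec.const 1)))
      (Primrec.ite ((Primrec.eq.comp hhalf (Primrec.const 0)).or (hR.comp h₁ hhalf))
        (Primrec.const 1) (Primrec.const 0))
  obtain ⟨cadj, hcadj⟩ := Code.exists_code.1 (Partrec.nat_iff.1 hadj.to_comp.partrec)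
  obtain ⟨cdeg, hcdeg⟩ := Code.exists_code.1 (Partrec.nat_iff.1 hdeg.to_comp.partrec)
  -- The s-m-n theorem: fixing the parameter `a` in one program serving the whole family.
  have hcurry : ∀ c : Code, Primrec fun a => c.curry a := fun c =>
    Code.primrec₂_curry.comp (Primrec.const c) Primrec.id
  refine ⟨fun a => (Code.const 1, cadj.curry a, cdeg.curry a),
    ((Primrec.const _).pair ((hcurry cadj).pair (hcurry cdeg))).to_comp, fun a => ⟨?_, ?_, ?_, ?_⟩⟩
  · intro v
    simp [charFn]
  · intro u v
    rw [Code.eval_curry, hcadj]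
    simp only [PFun.coe_val, Nat.unpair_pair, charFn]
    congr 2
    refine propext ⟨fun h => ⟨vtx u, vtx v, h, rfl⟩, ?_⟩
    rintro ⟨x, y, h, hxy⟩
    obtain ⟨rfl, rfl⟩ := Nat.pair_eq_pair.1 hxy
    exact h
  · intro v
    obtain ⟨S, hS, -⟩ := image_vtx_neighbors (R a) v
    exact hS ▸ S.finite_toSet.image _
  · intro v n
    obtain ⟨S, hS, hcard⟩ := image_vtx_neighbors (R a) v
    have hncard : ((ladder (R a)).neighborSet (vtx v)).ncard = S.card := by
      rw [hS, Set.ncard_image_of_injective _ vtx_injective, Set.ncard_coe_finset]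
    rw [Code.eval_curry, hcdeg]
    simp only [PFun.coe_val, Nat.unpair_pair, Part.mem_some_iff]
    rw [← hcard, ← hncard]
    exact ⟨fun h => ⟨trivial, h.symm⟩, fun ⟨_, h⟩ => h.symm⟩

/-! ### Bounding rungs with the help of a separating function -/

/-- Pairing dominates both components, so the code of a list bounds every number occurring in it.
Thus the raw output of the oracle is already a bound, with no decoding needed. -/
theorem Lists.edgesBelow {l : List (ℕ × ℕ)} {E : Finset (Sym2 (Set.univ : Set ℕ))}
    (h : Lists l E) : EdgesBelow E (encode l + 1) := by
  have hlt : ∀ p ∈ l, encode p < encode l := by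
    clear h
    intro p hp
    induction l with
    | nil => simp at hp
    | cons q l ih =>
      rw [encode_list_cons, Nat.lt_succ_iff]
      rcases List.mem_cons.1 hp with rfl | hp
      · exact Nat.left_le_pair _ _
      · exact (ih hp).le.trans (Nat.right_le_pair _ _)
  intro e he x hx
  obtain ⟨p, hp, hep⟩ : Sym2.map (fun x : (Set.univ : Set ℕ) => (x : ℕ)) e ∈
      {e | ∃ p ∈ l, e = s(p.1, p.2)} := h ▸ Set.mem_image_of_mem _ he
  have hxp : (x : ℕ) ∈ s(p.1, p.2) := hep ▸ Sym2.mem_map.2 ⟨x, hx, rfl⟩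
  have hpl := hlt p hp
  rw [encode_prod_val] at hpl
  rcases Sym2.mem_iff.1 hxp with h | h
  · have := Nat.left_le_pair (encode p.1) (encode p.2)
    simp only [encode_nat] at this hpl
    omega
  · have := Nat.right_le_pair (encode p.1) (encode p.2)
    simp only [encode_nat] at this hpl
    omega

/-- Relative to a function finding separating edge sets, one can compute bounds for those members
of a uniformly primitive recursive family of sets which are finite. -/
theorem FindsSepmax.exists_recursiveIn_bound {f : GraphCode →. List (ℕ × ℕ)} (hf : FindsSepmax f)
    {R : ℕ → ℕ → Prop} (hR : PrimrecRel R) :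
    ∃ b : ℕ → ℕ, Nat.RecursiveIn {natOracle f} (fun a => Part.some (b a)) ∧
      ∀ a, {n | R a n}.Finite → ∀ n, R a n → n ≤ b a := by
  obtain ⟨d, hd, hdes⟩ := exists_computable_describes_ladder hR
  -- Needs no finiteness of `R a`: a ladder never has more than two ends. Hence the bound is a total
  -- function.
  have h : ∀ a, ∃ l ∈ f (d a), ∃ E ∈ sepmax (ladder (R a)), Lists l E := fun a =>
    hf (d a) Set.univ (ladder (R a)) (hdes a) Set.infinite_univ (ladder_connected _)
      (numEnds_ladder_ne_top _)
  choose l hl E hE hlE using h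
  refine ⟨fun a => encode (l a), ?_, fun a hfin n hn => ?_⟩
  · have hd' : Nat.RecursiveIn {natOracle f} (fun a => Part.some (encode (d a))) :=
      (Partrec.nat_iff.1 (Computable.encode.comp hd).partrec).recursiveIn
    refine ((Nat.RecursiveIn.oracle _ (Set.mem_singleton _)).comp hd').of_eq fun a => ?_
    refine (Part.bind_some _ _).trans ?_
    rw [natOracle, encodek, Part.coe_some, Part.bind_some, Part.eq_some_iff.2 (hl a),
      Part.map_some]
  · have := lt_of_mem_sepmax_ladder hfin (hE a) (hlE a).edgesBelow hn
    dsimp only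
    omega

theorem FindsSepmax.recursiveIn_charFn_finite {f : GraphCode →. List (ℕ × ℕ)} (hf : FindsSepmax f)
    {R : ℕ → ℕ → Prop} (hR : PrimrecRel R) :
    Nat.RecursiveIn {natOracle f} (setOracle {e | {s | R e s}.Finite}) := by
  classical
  have h₁ : Primrec fun p : ℕ => p.unpair.1 := Primrec.fst.comp Primrec.unpair
  have h₂ : Primrec fun p : ℕ => p.unpair.2 := Primrec.snd.comp Primrec.unpair
  obtain ⟨b, hb, hbR⟩ := hf.exists_recursiveIn_bound hR
  let T : ℕ → ℕ × ℕ → Prop := fun s q => q.2 < s ∧ R q.1 s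
  have hT : PrimrecRel T := (Primrec.nat_lt.comp (Primrec.snd.comp Primrec.snd) Primrec.fst).and
    (hR.comp (Primrec.fst.comp Primrec.snd) Primrec.fst)
  -- With `p` coding `(e, m)`, `F p` holds at most at one number: the least `s > m` with `R e s`.
  let F : ℕ → ℕ → Prop := fun p s => T s p.unpair ∧ ∀ s' < s, ¬ T s' p.unpair
  have hF : PrimrecRel F :=
    (hT.comp Primrec.snd (Primrec.unpair.comp Primrec.fst)).and
      ((hT.not.forall_mem_list.comp (Primrec.list_range.comp Primrec.snd)
        (Primrec.unpair.comp Primrec.fst)).of_eq fun q => by simp)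
  obtain ⟨b', hb', hbF⟩ := hf.exists_recursiveIn_bound hF
  have hFfin : ∀ p, {s | F p s}.Finite := fun p => Set.Subsingleton.finite fun s hs t ht =>
    le_antisymm (not_lt.1 fun h => hs.2 _ h ht.1) (not_lt.1 fun h => ht.2 _ h hs.1)
  -- If some element exceeds `b e`, the least such one is at most `b'` at `(e, b e)`, so the bounded
  -- search finds it; conversely a finite set has no element above `b e`.
  have hiff : ∀ e, {s | R e s}.Finite ↔ ∀ s < b' (Nat.pair e (b e)) + 1, ¬ T s (e, b e) := by
    refine fun e => ⟨fun hfin s _ hs => hs.1.not_ge (hbR e hfin s hs.2), fun h => ?_⟩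
    refine (Set.finite_le_nat (b e)).subset fun s hs => ?_
    by_contra hlt
    have hex : ∃ s, T s (e, b e) := ⟨s, not_le.1 hlt, hs⟩
    refine h (Nat.find hex) (Nat.lt_succ_of_le ?_) (Nat.find_spec hex)
    refine hbF _ (hFfin _) _ ⟨?_, fun s' hs' => ?_⟩
    · rw [Nat.unpair_pair]
      exact Nat.find_spec hex
    · rw [Nat.unpair_pair]
      exact Nat.find_min hex hs'
  have hout : Primrec fun q : ℕ =>
      if ∀ s < q.unpair.2 + 1, ¬ T s q.unpair.1.unpair then 1 else 0 :=
    Primrec.ite ((hT.not.forall_mem_list.comp (Primrec.list_range.comp (Primrec.succ.comp h₂))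
      (Primrec.unpair.comp h₁)).of_eq fun q => by simp) (Primrec.const 1) (Primrec.const 0)
  have hpair : Nat.RecursiveIn {natOracle f} fun e => Part.some (Nat.pair e (b e)) :=
    (Nat.RecursiveIn.pair (Partrec.nat_iff.1 Partrec.some).recursiveIn hb).of_eq fun e => by
      simp [Seq.seq]
  have hall : Nat.RecursiveIn {natOracle f} fun e =>
      Part.some (Nat.pair (Nat.pair e (b e)) (b' (Nat.pair e (b e)))) :=
    (Nat.RecursiveIn.pair hpair (Nat.RecursiveIn.comp hb' hpair)).of_eq fun e => by
      simp [Seq.seq]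
  refine (Nat.RecursiveIn.comp (Partrec.nat_iff.1 hout.to_comp.partrec).recursiveIn hall).of_eq
    fun e => ?_
  refine (Part.bind_some _ _).trans ?_
  simp [setOracle, charFn, hiff]

end SepMax

theorem mainTheorem8 (f : SepMax.GraphCode →. List (ℕ × ℕ)) (hf : SepMax.FindsSepmax f) :
    TuringReducible (SepMax.setOracle (SepMax.jump (SepMax.jump ∅))) (SepMax.natOracle f) := by
  obtain ⟨R, hR, hjump⟩ := SepMax.exists_jump_jump_empty_iff_finite
  rw [TuringReducible, RecursiveIn.iff_nat, show SepMax.jump (SepMax.jump ∅) = _ from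
    Set.ext hjump]
  exact hf.recursiveIn_charFn_finite hR
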